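/- Let $X$ be a complex Hilbert space with open unit ball $B=\{z\in X:\|z\|<1\}$. A mapping $f:B\to X$ is holomorphic if it is complex Fréchet differentiable at every point of $B$, with derivative $Df(z)$; it is biholomorphic if moreover $f(B)$ is a domain and $f$ has an inverse that is holomorphic on $f(B)$. Let $K(B)$ be the class of biholomorphic mappings $f:B\to X$ with $f(0)=0$, $Df(0)=I$ and $f(B)$ convex, and let $S^{*}(B)$ be the class of biholomorphic mappings $f:B\to X$ with $f(0)=0$, $Df(0)=I$ and $t f(B)\subset f(B)$ for all $0\le t\le 1$. Let $0\le\alpha<1$ and put $$A(\alpha)=\begin{cases}\dfrac{(2-\alpha)\sqrt{1-2\alpha}}{\sqrt{5-2\alpha}}, & 0\le\alpha\le\frac14,\\[2mm] \dfrac{(2-\alpha)(1-\alpha)}{2+\alpha}, & \frac14<\alpha\le\frac25,\\[1mm] \alpha, & \frac25<\alpha<\frac12,\\ 1-\alpha, & \frac12\le\alpha<1.\end{cases}$$ Let $SK(B,\alpha)$ be the class of holomorphic mappings $f:B\to X$ with an expansion $f(z)=z+\sum_{k=2}^{\infty}A_k(z^k)$ on $B$, where each $A_k:X^k\to X$ is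 a bounded symmetric $k$-linear operator and $A_k(z^k)=A_k(z,\dots,z)$, such that $\sum_{k=2}^{\infty}k(k-\alpha)\|A_k\|\le A(\alpha)$. Let $SS^{*}(B,\alpha)$ be the class of such mappings with $\sum_{k=2}^{\infty}(k-\alpha)\|A_k\|\le A(\alpha)$ instead. Then $SK(B,\alpha)\subset K(B)$ and $SS^{*}(B,\alpha)\subset S^{*}(B)$. Moreover, for every holomorphic mapping $f:B\to X$ with $f(0)=0$, one has $f\in SK(B,\alpha)$ if and only if the mapping $z\mapsto Df(z)z$ belongs to $SS^{*}(B,\alpha)$. -/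

import Mathlib

/-- The constant `A(α)`, for `0 ≤ α < 1`. -/
noncomputable def AConst (α : ℝ) : ℝ :=
  if α ≤ 1 / 4 then (2 - α) * Real.sqrt (1 - 2 * α) / Real.sqrt (5 - 2 * α)
  else if α ≤ 2 / 5 then (2 - α) * (1 - α) / (2 + α)
  else if α < 1 / 2 then α
  else 1 - α

section

variable {X : Type*} [NormedAddCommGroup X] [InnerProductSpace ℂ X]

/-- `f` is biholomorphic on `G`: it is holomorphic on `G`, `f(G)` is a domain, and the inverse
exists and is holomorphic on `f(G)`. -/
def BiholomorphicOn (f : X → X) (G : Set X) : Prop :=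
  DifferentiableOn ℂ f G ∧ IsOpen (f '' G) ∧ IsConnected (f '' G) ∧
    ∃ g : X → X, Set.LeftInvOn g f G ∧ DifferentiableOn ℂ g (f '' G)

/-- `f` is locally biholomorphic on `G`. -/
def LocallyBiholomorphicOn (f : X → X) (G : Set X) : Prop :=
  ∀ z ∈ G, ∃ U : Set X, IsOpen U ∧ z ∈ U ∧ U ⊆ G ∧ BiholomorphicOn f U

/-- The class `N(B)` of normalized locally biholomorphic mappings on the unit ball. Mappings on
`B` are represented by functions on `X` of which only the values on `B` matter. -/
def classN (X : Type*) [NormedAddCommGroup X] [InnerProductSpace ℂ X] : Set (X → X) :=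
  {f | LocallyBiholomorphicOn f (Metric.ball 0 1) ∧ f 0 = 0 ∧
    HasFDerivAt f (ContinuousLinearMap.id ℂ X) 0}

/-- The class `S*(B)` of normalized biholomorphic starlike mappings on the unit ball. -/
def classSStar (X : Type*) [NormedAddCommGroup X] [InnerProductSpace ℂ X] : Set (X → X) :=
  {f | f ∈ classN X ∧ BiholomorphicOn f (Metric.ball 0 1) ∧
    ∀ t : ℝ, 0 ≤ t → t ≤ 1 → ∀ w ∈ f '' Metric.ball (0 : X) 1,
      (t : ℂ) • w ∈ f '' Metric.ball (0 : X) 1}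

/-- The class `K(B)` of normalized biholomorphic convex mappings on the unit ball. -/
def classK (X : Type*) [NormedAddCommGroup X] [InnerProductSpace ℂ X] : Set (X → X) :=
  {f | BiholomorphicOn f (Metric.ball 0 1) ∧
    (∀ z₁ ∈ Metric.ball (0 : X) 1, ∀ z₂ ∈ Metric.ball (0 : X) 1, ∀ t : ℝ, 0 ≤ t → t ≤ 1 →
      (1 - (t : ℂ)) • f z₁ + (t : ℂ) • f z₂ ∈ f '' Metric.ball (0 : X) 1) ∧
    f 0 = 0 ∧ HasFDerivAt f (ContinuousLinearMap.id ℂ X) 0}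

/-- `f` is holomorphic on the unit ball `B`, with expansion `f(z) = z + ∑_{k ≥ 2} A_k(z^k)` there,
where the `A_k` are bounded symmetric `k`-linear operators. The operators `A 0` and `A 1` do not
enter the expansion. -/
def HasNormalizedExpansion (f : X → X)
    (A : (k : ℕ) → ContinuousMultilinearMap ℂ (fun _ : Fin k => X) X) : Prop :=
  DifferentiableOn ℂ f (Metric.ball 0 1) ∧
  (∀ (k : ℕ) (σ : Equiv.Perm (Fin k)) (v : Fin k → X), A k (fun i => v (σ i)) = A k v) ∧
  ∀ z ∈ Metric.ball (0 : X) 1, HasSum (fun k : ℕ => A (k + 2) (fun _ => z)) (f z - z)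

/-- The class `SK(B, α)`: normalized series with `∑_{k ≥ 2} k (k - α) ‖A_k‖ ≤ A(α)`. -/
def classSK (X : Type*) [NormedAddCommGroup X] [InnerProductSpace ℂ X] (α : ℝ) : Set (X → X) :=
  {f | ∃ A : (k : ℕ) → ContinuousMultilinearMap ℂ (fun _ : Fin k => X) X,
    HasNormalizedExpansion f A ∧
    Summable (fun k : ℕ => ((k + 2 : ℕ) : ℝ) * (((k + 2 : ℕ) : ℝ) - α) * ‖A (k + 2)‖) ∧
    ∑' k : ℕ, ((k + 2 : ℕ) : ℝ) * (((k + 2 : ℕ) : ℝ) - α) * ‖A (k + 2)‖ ≤ AConst α}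

/-- The class `SS*(B, α)`: normalized series with `∑_{k ≥ 2} (k - α) ‖A_k‖ ≤ A(α)`. -/
def classSSStar (X : Type*) [NormedAddCommGroup X] [InnerProductSpace ℂ X] (α : ℝ) :
    Set (X → X) :=
  {f | ∃ A : (k : ℕ) → ContinuousMultilinearMap ℂ (fun _ : Fin k => X) X,
    HasNormalizedExpansion f A ∧
    Summable (fun k : ℕ => (((k + 2 : ℕ) : ℝ) - α) * ‖A (k + 2)‖) ∧
    ∑' k : ℕ, (((k + 2 : ℕ) : ℝ) - α) * ‖A (k + 2)‖ ≤ AConst α}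

end

/-! Write f = id + h and S = ∑ k‖A_k‖. Since (2-α)k/2 ≤ k-α for k ≥ 2, the SS* condition gives S ≤
2A(α)/(2-α). As √5·A(α) ≤ 2-α, this yields S ≤ 2/√5 < 1. The SK condition is the same condition with
k‖A_k‖ in place of ‖A_k‖, so it bounds ∑ k²‖A_k‖ by 2/√5. In both cases ‖Dh‖ ≤ S < 1 on B, and the
inverse function theorem for perturbations of the identity makes f biholomorphic.

Starlikeness: w = Df(v)⁻¹f(v) solves w + Dh(v)w = v + h(v), where ‖Dh(v)‖ ≤ S‖v‖ and ‖h(v)‖ ≤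
S‖v‖²/2. Cauchy–Schwarz with S² ≤ 4/5 gives Re⟨v,w⟩ > 0 (`re_inner_pos_of_perturbation`). Hence the
preimage of a point moving radially towards 0 has decreasing norm and never leaves B
(`starlike_of_perturbation`).

Convexity: f almost preserves convex combinations, with an error controlled by the Lipschitz
constant of Dh. In a Hilbert space the combination of two points of B lies deep enough inside B to
absorb that error (`convex_combination_mem_image`).

The equivalence holds because f ↦ Df(z)z multiplies A_k by k, and because f is recovered from Df(z)z
by integrating along rays. -/

open Metric Set Filter Topology

/-! ### Termwise differentiation and bounds for power series on the ball. -/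

section Expansion

variable {X : Type*} [NormedAddCommGroup X] [InnerProductSpace ℂ X]

/-- The derivative of `z ↦ A(z, …, z)` for a symmetric `A`. -/
noncomputable def diagDeriv {n : ℕ} (A : ContinuousMultilinearMap ℂ (fun _ : Fin (n + 1) => X) X)
    (z : X) : X →L[ℂ] X :=
  ((n : ℂ) + 1) •
    (ContinuousMultilinearMap.apply ℂ (fun _ : Fin n => X) X (fun _ => z)).comp A.curryLeft

lemma diagDeriv_apply {n : ℕ} (A : ContinuousMultilinearMap ℂ (fun _ : Fin (n + 1) => X) X)
    (z v : X) : diagDeriv A z v = ((n : ℂ) + 1) • A (Fin.cons v fun _ => z) := rfl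

lemma diagDeriv_self {n : ℕ} (A : ContinuousMultilinearMap ℂ (fun _ : Fin (n + 1) => X) X)
    (z : X) : diagDeriv A z z = ((n : ℂ) + 1) • A fun _ => z := by
  rw [diagDeriv_apply]
  congr 2
  funext i
  refine Fin.cases ?_ (fun j => ?_) i <;> simp

lemma hasFDerivAt_diag {n : ℕ} {A : ContinuousMultilinearMap ℂ (fun _ : Fin (n + 1) => X) X}
    (hA : ∀ (σ : Equiv.Perm (Fin (n + 1))) (v : Fin (n + 1) → X), A (fun i => v (σ i)) = A v)
    (z : X) : HasFDerivAt (fun z => A fun _ => z) (diagDeriv A z) z := by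
  have h := (A.hasFDerivAt (fun _ => z)).comp z
    (hasFDerivAt_pi.2 fun _ : Fin (n + 1) => hasFDerivAt_id (𝕜 := ℂ) z)
  refine h.congr_fderiv ?_
  ext v
  -- By symmetry, swapping slots 0 and i makes all n + 1 partial terms equal, whence the factor n +
  -- 1.
  have key : ∀ i : Fin (n + 1),
      A (Function.update (fun _ => z) i v) = A (Fin.cons v fun _ => z) := by
    intro i
    rw [← hA (Equiv.swap 0 i) (Fin.cons v fun _ => z)]
    congr 1
    funext j
    rcases eq_or_ne j i with rfl | hj
    · simp
    · rw [Function.update_of_ne hj]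
      have h0 : Equiv.swap 0 i j ≠ 0 := by
        intro h
        apply hj
        have := congrArg (Equiv.swap 0 i) h
        simpa using this
      obtain ⟨k, hk⟩ := Fin.exists_succ_eq.2 h0
      rw [← hk, Fin.cons_succ]
  simp [ContinuousMultilinearMap.linearDeriv_apply, key, diagDeriv_apply, ← Nat.cast_smul_eq_nsmul ℂ]

lemma norm_diagDeriv_le {n : ℕ} (A : ContinuousMultilinearMap ℂ (fun _ : Fin (n + 1) => X) X)
    (z : X) : ‖diagDeriv A z‖ ≤ (n + 1) * ‖A‖ * ‖z‖ ^ n := by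
  refine ContinuousLinearMap.opNorm_le_bound _ (by positivity) fun v => ?_
  have h := A.le_opNorm (Fin.cons v fun _ => z)
  rw [Fin.prod_univ_succ] at h
  simp only [Fin.cons_zero, Fin.cons_succ, Finset.prod_const, Finset.card_univ,
    Fintype.card_fin] at h
  have hn : ‖(n : ℂ) + 1‖ = n + 1 := by
    rw [← Nat.cast_succ, Complex.norm_natCast, Nat.cast_succ]
  rw [diagDeriv_apply, norm_smul, hn]
  calc ((n : ℝ) + 1) * ‖A (Fin.cons v fun _ => z)‖ ≤ (n + 1) * (‖A‖ * (‖v‖ * ‖z‖ ^ n)) := by gcongr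
    _ = _ := by ring

lemma norm_diagDeriv_sub_le {n : ℕ} (A : ContinuousMultilinearMap ℂ (fun _ : Fin (n + 1) => X) X)
    {x y : X} (hx : ‖x‖ ≤ 1) (hy : ‖y‖ ≤ 1) :
    ‖diagDeriv A x - diagDeriv A y‖ ≤ (n + 1) * n * ‖A‖ * ‖x - y‖ := by
  refine ContinuousLinearMap.opNorm_le_bound _ (by positivity) fun v => ?_
  have hn : ‖(n : ℂ) + 1‖ = n + 1 := by
    rw [← Nat.cast_succ, Complex.norm_natCast, Nat.cast_succ]
  have h := (A.curryLeft v).norm_image_sub_le (fun _ => x) (fun _ => y)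
  have e : (diagDeriv A x - diagDeriv A y) v
      = ((n : ℂ) + 1) • (A.curryLeft v (fun _ => x) - A.curryLeft v (fun _ => y)) := by
    rw [smul_sub]; rfl
  have h1 : ‖A.curryLeft v‖ ≤ ‖A‖ * ‖v‖ := by
    simpa using A.curryLeft.le_opNorm v
  have h2 : ‖((fun _ => x) : Fin n → X) - fun _ => y‖ ≤ ‖x - y‖ :=
    pi_norm_const_le (x - y)
  have h3 : max ‖((fun _ => x) : Fin n → X)‖ ‖((fun _ => y) : Fin n → X)‖ ≤ 1 :=
    max_le ((pi_norm_const_le x).trans hx) ((pi_norm_const_le y).trans hy)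
  rw [e, norm_smul, hn]
  calc ((n : ℝ) + 1) * _ ≤ (n + 1) * (‖A‖ * ‖v‖ * n * 1 * ‖x - y‖) := by
        gcongr
        refine h.trans ?_
        rw [Fintype.card_fin]
        gcongr
        exact pow_le_one₀ (le_max_of_le_left (norm_nonneg _)) h3
    _ = _ := by ring

variable {A : (k : ℕ) → ContinuousMultilinearMap ℂ (fun _ : Fin k => X) X}

lemma norm_diagDeriv_add_two_le (k : ℕ) {z : X} (hz : ‖z‖ ≤ 1) :
    ‖diagDeriv (A (k + 2)) z‖ ≤ ((k + 2 : ℕ) : ℝ) * ‖A (k + 2)‖ * ‖z‖ := by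
  refine (norm_diagDeriv_le (A (k + 2)) z).trans ?_
  have : ‖z‖ ^ (k + 1) ≤ ‖z‖ := by
    rw [pow_succ]
    exact mul_le_of_le_one_left (norm_nonneg _) (pow_le_one₀ (norm_nonneg _) hz)
  calc _ ≤ ((k + 1 : ℕ) + 1 : ℝ) * ‖A (k + 2)‖ * ‖z‖ := by gcongr
    _ = _ := by push_cast; ring

/-- The derivative of `z ↦ ∑_{k ≥ 2} A_k(z^k)`. -/
noncomputable def seriesDeriv (A : (k : ℕ) → ContinuousMultilinearMap ℂ (fun _ : Fin k => X) X)
    (z : X) : X →L[ℂ] X := ∑' k, diagDeriv (A (k + 2)) z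

lemma summable_diagDeriv [CompleteSpace X]
    (hs : Summable fun k : ℕ => ((k + 2 : ℕ) : ℝ) * ‖A (k + 2)‖) {z : X} (hz : ‖z‖ ≤ 1) :
    Summable fun k => diagDeriv (A (k + 2)) z :=
  Summable.of_norm_bounded (hs.mul_right ‖z‖) fun k => norm_diagDeriv_add_two_le k hz

lemma norm_seriesDeriv_le
    (hs : Summable fun k : ℕ => ((k + 2 : ℕ) : ℝ) * ‖A (k + 2)‖) {z : X} (hz : ‖z‖ ≤ 1) :
    ‖seriesDeriv A z‖ ≤ (∑' k : ℕ, ((k + 2 : ℕ) : ℝ) * ‖A (k + 2)‖) * ‖z‖ := by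
  rw [← tsum_mul_right]
  exact tsum_of_norm_bounded (hs.mul_right ‖z‖).hasSum fun k => norm_diagDeriv_add_two_le k hz

lemma hasSum_seriesDeriv_self [CompleteSpace X]
    (hs : Summable fun k : ℕ => ((k + 2 : ℕ) : ℝ) * ‖A (k + 2)‖) {z : X} (hz : ‖z‖ ≤ 1) :
    HasSum (fun k : ℕ => ((k + 2 : ℕ) : ℂ) • A (k + 2) fun _ => z) (seriesDeriv A z z) := by
  have h := (summable_diagDeriv hs hz).hasSum.mapL (ContinuousLinearMap.apply ℂ X z)
  convert h using 2 with k
  rw [ContinuousLinearMap.apply_apply, diagDeriv_self]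
  · push_cast
    ring_nf
  · rfl

lemma summable_diag [CompleteSpace X]
    (hs : Summable fun k : ℕ => ((k + 2 : ℕ) : ℝ) * ‖A (k + 2)‖) {z : X} (hz : ‖z‖ ≤ 1) :
    Summable fun k : ℕ => A (k + 2) fun _ => z := by
  refine Summable.of_norm_bounded hs fun k => ?_
  refine ((A (k + 2)).le_opNorm _).trans ?_
  simp only [Finset.prod_const, Finset.card_univ, Fintype.card_fin]
  rw [mul_comm]
  gcongr
  refine (pow_le_one₀ (norm_nonneg _) hz).trans ?_
  push_cast
  linarith [(Nat.cast_nonneg k : (0 : ℝ) ≤ k)]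

lemma hasFDerivAt_series [CompleteSpace X]
    (hs : Summable fun k : ℕ => ((k + 2 : ℕ) : ℝ) * ‖A (k + 2)‖)
    (hA : ∀ (k : ℕ) (σ : Equiv.Perm (Fin k)) (v : Fin k → X), A k (fun i => v (σ i)) = A k v)
    {z : X} (hz : z ∈ ball (0 : X) 1) :
    HasFDerivAt (fun z => ∑' k, A (k + 2) fun _ => z) (seriesDeriv A z) z := by
  have hb : ∀ {w : X}, w ∈ ball (0 : X) 1 → ‖w‖ ≤ 1 := fun hw => (mem_ball_zero_iff.1 hw).le
  refine hasFDerivAt_tsum_of_isPreconnected hs isOpen_ball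
    (convex_ball (0 : X) 1).isPreconnected (fun k w _ => hasFDerivAt_diag (hA (k + 2)) w)
    (fun k w hw => ?_) hz (summable_diag hs (hb hz)) hz
  refine (norm_diagDeriv_add_two_le k (hb hw)).trans ?_
  exact mul_le_of_le_one_right (by positivity) (hb hw)

lemma HasNormalizedExpansion.hasFDerivAt [CompleteSpace X]
    (hs : Summable fun k : ℕ => ((k + 2 : ℕ) : ℝ) * ‖A (k + 2)‖)
    {f : X → X} (hf : HasNormalizedExpansion f A) {z : X} (hz : z ∈ ball (0 : X) 1) :
    HasFDerivAt f (ContinuousLinearMap.id ℂ X + seriesDeriv A z) z := by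
  refine ((hasFDerivAt_id z).add (hasFDerivAt_series hs hf.2.1 hz)).congr_of_eventuallyEq ?_
  filter_upwards [isOpen_ball.mem_nhds hz] with w hw
  simp [(hf.2.2 w hw).tsum_eq]

/-- For k ≥ 2 one has 1 ≤ k/2 and ‖z‖^k ≤ ‖z‖². The gain of 1/2 is what turns into the constant 1 +
1/4 = 5/4 in the starlikeness estimate. -/
lemma norm_series_le
    (hs : Summable fun k : ℕ => ((k + 2 : ℕ) : ℝ) * ‖A (k + 2)‖) {z : X} (hz : ‖z‖ ≤ 1) :
    ‖∑' k : ℕ, A (k + 2) fun _ => z‖ ≤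
      (∑' k : ℕ, ((k + 2 : ℕ) : ℝ) * ‖A (k + 2)‖) / 2 * ‖z‖ ^ 2 := by
  rw [div_mul_eq_mul_div, mul_div_assoc, ← tsum_mul_right]
  refine tsum_of_norm_bounded (hs.mul_right _).hasSum fun k => ?_
  refine ((A (k + 2)).le_opNorm _).trans ?_
  simp only [Finset.prod_const, Finset.card_univ, Fintype.card_fin]
  have h1 : ‖z‖ ^ (k + 2) ≤ ‖z‖ ^ 2 := pow_le_pow_of_le_one (norm_nonneg _) hz (by omega)
  push_cast
  nlinarith [mul_nonneg (Nat.cast_nonneg k : (0 : ℝ) ≤ k)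
    (mul_nonneg (norm_nonneg (A (k + 2))) (sq_nonneg ‖z‖)),
    mul_le_mul_of_nonneg_left h1 (norm_nonneg (A (k + 2)))]

lemma norm_seriesDeriv_sub_le [CompleteSpace X]
    (hs : Summable fun k : ℕ => ((k + 2 : ℕ) : ℝ) * ‖A (k + 2)‖)
    (hs' : Summable fun k : ℕ => ((k + 2 : ℕ) : ℝ) * (k + 1 : ℕ) * ‖A (k + 2)‖)
    {x y : X} (hx : ‖x‖ ≤ 1) (hy : ‖y‖ ≤ 1) :
    ‖seriesDeriv A x - seriesDeriv A y‖ ≤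
      (∑' k : ℕ, ((k + 2 : ℕ) : ℝ) * (k + 1 : ℕ) * ‖A (k + 2)‖) * ‖x - y‖ := by
  rw [seriesDeriv, seriesDeriv,
    ← (summable_diagDeriv hs hx).tsum_sub (summable_diagDeriv hs hy), ← tsum_mul_right]
  refine tsum_of_norm_bounded (hs'.mul_right _).hasSum fun k => ?_
  refine (norm_diagDeriv_sub_le (A (k + 2)) hx hy).trans_eq ?_
  push_cast
  ring

end Expansion

/-! ### Perturbations of the identity: inversion and convexity of the image. -/

section Perturbation

variable {X : Type*} [NormedAddCommGroup X] [InnerProductSpace ℂ X]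

lemma approximatesLinearOn_id {f : X → X} {H : X → X →L[ℂ] X} {a : NNReal} {s : Set X}
    (hc : Convex ℝ s)
    (hf : ∀ z ∈ s, HasFDerivAt f (ContinuousLinearMap.id ℂ X + H z) z)
    (hH : ∀ z ∈ s, ‖H z‖ ≤ a) :
    ApproximatesLinearOn f (ContinuousLinearEquiv.refl ℂ X : X →L[ℂ] X) s a := by
  intro x hx y hy
  refine hc.norm_image_sub_le_of_norm_hasFDerivWithin_le'
    (fun z hz => (hf z hz).hasFDerivWithinAt) (fun z hz => ?_) hy hx
  have : ContinuousLinearMap.id ℂ X + H z - (ContinuousLinearEquiv.refl ℂ X : X →L[ℂ] X) = H z := by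
    ext v; simp
  rw [this]
  exact hH z hz

/-- The identity has norm 1 only on a nontrivial space, so the zero space is split off. -/
lemma subsingleton_or_lt_refl_inv {a : NNReal} (ha : a < 1) :
    Subsingleton X ∨ a < ‖((ContinuousLinearEquiv.refl ℂ X).symm : X →L[ℂ] X)‖₊⁻¹ := by
  rcases subsingleton_or_nontrivial X with h | h
  · exact Or.inl h
  · right
    have : ‖((ContinuousLinearEquiv.refl ℂ X).symm : X →L[ℂ] X)‖₊ = 1 := by
      rw [← NNReal.coe_inj]
      exact ContinuousLinearMap.norm_id
    rwa [this, inv_one]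

lemma exists_equiv_of_norm_lt_one [CompleteSpace X] {T : X →L[ℂ] X} (hT : ‖T‖ < 1) :
    ∃ e : X ≃L[ℂ] X, (e : X →L[ℂ] X) = ContinuousLinearMap.id ℂ X + T := by
  have hT' : ‖-T‖ < 1 := by rwa [norm_neg]
  refine ⟨ContinuousLinearEquiv.ofUnit (Units.oneSub (-T) hT'), ?_⟩
  ext v
  simp [ContinuousLinearEquiv.ofUnit]

/-- A perturbation of the identity with derivative bounded by `a < 1` has a differentiable local
inverse on the whole ball. -/
lemma exists_openPartialHomeomorph [CompleteSpace X] {f : X → X} {H : X → X →L[ℂ] X} {a : NNReal}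
    (ha : a < 1)
    (hf : ∀ z ∈ ball (0 : X) 1, HasFDerivAt f (ContinuousLinearMap.id ℂ X + H z) z)
    (hH : ∀ z ∈ ball (0 : X) 1, ‖H z‖ ≤ a) :
    ∃ e : OpenPartialHomeomorph X X, e.source = ball 0 1 ∧ e.target = f '' ball 0 1 ∧
      (∀ z, e z = f z) ∧ ∀ z ∈ ball (0 : X) 1, ∃ D : X →L[ℂ] X,
        HasFDerivAt e.symm D (f z) ∧ ∀ v, D v + H z (D v) = v := by
  have hA := approximatesLinearOn_id (convex_ball (0 : X) 1) hf hH
  have hc := subsingleton_or_lt_refl_inv (X := X) ha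
  refine ⟨hA.toOpenPartialHomeomorph f _ hc isOpen_ball, rfl, rfl, fun _ => rfl, fun z hz => ?_⟩
  set e := hA.toOpenPartialHomeomorph f _ hc isOpen_ball
  obtain ⟨E, hE⟩ := exists_equiv_of_norm_lt_one ((hH z hz).trans_lt (by exact_mod_cast ha))
  have hz' : z ∈ e.source := hz
  have hinv : e.symm (f z) = z := e.left_inv hz'
  have hT : f z ∈ e.target := e.map_source hz'
  refine ⟨E.symm, ?_, fun v => ?_⟩
  · refine e.hasFDerivAt_symm hT ?_
    rw [hinv, hE]
    exact hf z hz
  · have := E.apply_symm_apply v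
    rw [← ContinuousLinearEquiv.coe_coe E, hE] at this
    simpa using this

lemma biholomorphicOn_of_perturbation [CompleteSpace X] {f : X → X} {H : X → X →L[ℂ] X}
    {a : NNReal} (ha : a < 1)
    (hf : ∀ z ∈ ball (0 : X) 1, HasFDerivAt f (ContinuousLinearMap.id ℂ X + H z) z)
    (hH : ∀ z ∈ ball (0 : X) 1, ‖H z‖ ≤ a) :
    BiholomorphicOn f (ball 0 1) := by
  have hd : DifferentiableOn ℂ f (ball 0 1) :=
    fun z hz => (hf z hz).differentiableAt.differentiableWithinAt
  obtain ⟨e, hs, ht, he, hD⟩ := exists_openPartialHomeomorph ha hf hH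
  refine ⟨hd, ht ▸ e.open_target, ⟨⟨f 0, 0, by simp, rfl⟩,
    (convex_ball (0 : X) 1).isPreconnected.image f hd.continuousOn⟩, e.symm, fun z hz => ?_, ?_⟩
  · rw [← he]
    exact e.left_inv (hs ▸ hz)
  · rintro _ ⟨z, hz, rfl⟩
    obtain ⟨D, h, -⟩ := hD z hz
    exact h.differentiableAt.differentiableWithinAt

/-- The Hilbert space identity behind convexity: the last term measures how far the combination is
pushed into the ball. -/
lemma norm_convex_combination_sq (x y : X) (t : ℝ) :
    ‖(1 - (t : ℂ)) • x + (t : ℂ) • y‖ ^ 2 =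
      (1 - t) * ‖x‖ ^ 2 + t * ‖y‖ ^ 2 - t * (1 - t) * ‖x - y‖ ^ 2 := by
  have h1 : (1 - (t : ℂ)) = ((1 - t : ℝ) : ℂ) := by push_cast; rfl
  rw [h1, norm_add_sq (𝕜 := ℂ), norm_sub_sq (𝕜 := ℂ), norm_smul, norm_smul, inner_smul_left,
    inner_smul_right, Complex.norm_real, Complex.norm_real, Complex.conj_ofReal, mul_pow, mul_pow,
    Real.norm_eq_abs, Real.norm_eq_abs, sq_abs, sq_abs]
  simp only [RCLike.re_to_complex, Complex.re_ofReal_mul]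
  ring

/-- Taylor's estimate for a map whose derivative is `L`-Lipschitz. -/
lemma norm_image_sub_sub_le {h : X → X} {H : X → X →L[ℂ] X} {L : ℝ} {s : Set X}
    (hs : Convex ℝ s) (hh : ∀ z ∈ s, HasFDerivAt h (H z) z)
    (hL : ∀ x ∈ s, ∀ y ∈ s, ‖H x - H y‖ ≤ L * ‖x - y‖) {x y : X} (hx : x ∈ s) (hy : y ∈ s) :
    ‖h y - h x - H x (y - x)‖ ≤ L / 2 * ‖y - x‖ ^ 2 := by
  have hmem : ∀ t ∈ Icc (0 : ℝ) 1, x + (t : ℂ) • (y - x) ∈ s := by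
    intro t ht
    have := hs.add_smul_sub_mem hx hy ht
    simpa using this
  have hd : ∀ t ∈ Icc (0 : ℝ) 1,
      HasDerivAt (fun t : ℝ => h (x + (t : ℂ) • (y - x)) - h x - (t : ℂ) • H x (y - x))
        ((H (x + (t : ℂ) • (y - x)) - H x) (y - x)) t := by
    intro t ht
    have hl : HasDerivAt (fun t : ℝ => x + (t : ℂ) • (y - x)) (y - x) t := by
      simpa using ((Complex.ofRealCLM.hasDerivAt (x := t)).smul_const (y - x)).const_add x
    have hl' : HasDerivAt (fun t : ℝ => (t : ℂ) • H x (y - x)) (H x (y - x)) t := by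
      simpa using (Complex.ofRealCLM.hasDerivAt (x := t)).smul_const (H x (y - x))
    have := (((hh _ (hmem t ht)).restrictScalars ℝ).comp_hasDerivAt t hl).sub_const (h x)
    exact (this.sub hl').congr_deriv (by simp)
  have := image_norm_le_of_norm_deriv_right_le_deriv_boundary (a := 0) (b := 1)
    (B := fun t => L / 2 * ‖y - x‖ ^ 2 * t ^ 2) (B' := fun t => L * t * ‖y - x‖ ^ 2)
    (fun t ht => (hd t ht).continuousAt.continuousWithinAt)
    (fun t ht => (hd t (Ico_subset_Icc_self ht)).hasDerivWithinAt) (by simp)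
    (fun t => by
      have := ((hasDerivAt_id t).pow 2).const_mul (L / 2 * ‖y - x‖ ^ 2)
      refine this.congr_deriv ?_
      simp; ring)
    (fun t ht => by
      refine (ContinuousLinearMap.le_opNorm _ _).trans ?_
      have h1 := hL _ (hmem t (Ico_subset_Icc_self ht)) x hx
      rw [add_sub_cancel_left, norm_smul, Complex.norm_real, Real.norm_of_nonneg ht.1] at h1
      calc _ ≤ L * (t * ‖y - x‖) * ‖y - x‖ := by gcongr
        _ = _ := by ring)
    (right_mem_Icc.2 zero_le_one)
  simpa using this

/-- A perturbation `f` of the identity on the unit ball of a Hilbert space has convex image if its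
derivative is close to the identity and does not vary too fast. -/
lemma convex_combination_mem_image [CompleteSpace X] {f : X → X} {H : X → X →L[ℂ] X} {a : NNReal}
    {L : ℝ} (haL : L + a ≤ 1)
    (hf : ∀ z ∈ ball (0 : X) 1, HasFDerivAt f (ContinuousLinearMap.id ℂ X + H z) z)
    (hH : ∀ z ∈ ball (0 : X) 1, ‖H z‖ ≤ a)
    (hL : ∀ x ∈ ball (0 : X) 1, ∀ y ∈ ball (0 : X) 1, ‖H x - H y‖ ≤ L * ‖x - y‖)
    {x y : X} (hx : x ∈ ball (0 : X) 1) (hy : y ∈ ball (0 : X) 1) {t : ℝ} (ht0 : 0 ≤ t)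
    (ht1 : t ≤ 1) : (1 - (t : ℂ)) • f x + (t : ℂ) • f y ∈ f '' ball (0 : X) 1 := by
  have hA := approximatesLinearOn_id (convex_ball (0 : X) 1) hf hH
  set z := (1 - (t : ℂ)) • x + (t : ℂ) • y with hz
  set d := t * (1 - t) * ‖x - y‖ ^ 2 with hd
  have ht' : 0 ≤ 1 - t := by linarith
  have hd0 : 0 ≤ d := by positivity
  have hzn : ‖z‖ ^ 2 = (1 - t) * ‖x‖ ^ 2 + t * ‖y‖ ^ 2 - d := norm_convex_combination_sq x y t
  rw [mem_ball_zero_iff] at hx hy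
  have hlt : (1 - t) * ‖x‖ ^ 2 + t * ‖y‖ ^ 2 < 1 := by
    have h1 : ‖x‖ ^ 2 < 1 := by nlinarith [norm_nonneg x]
    have h2 : ‖y‖ ^ 2 < 1 := by nlinarith [norm_nonneg y]
    rcases eq_or_lt_of_le ht0 with rfl | h
    · simpa using h1
    · nlinarith
  -- Here ‖z‖² < 1 - d ≤ (1 - d/2)².
  have hzd : ‖z‖ + d / 2 < 1 := by
    have h3 : ‖z‖ ^ 2 < 1 - d := by linarith
    have h4 : d < 1 := by nlinarith [sq_nonneg ‖z‖]
    nlinarith [norm_nonneg z, sq_nonneg d]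
  have hzb : z ∈ ball (0 : X) 1 := by rw [mem_ball_zero_iff]; linarith
  have hsub : closedBall z (d / 2) ⊆ ball (0 : X) 1 := by
    intro w hw
    rw [mem_ball_zero_iff]
    rw [mem_closedBall, dist_eq_norm] at hw
    have := norm_le_norm_add_norm_sub z w
    rw [norm_sub_rev] at this
    linarith
  have htay : ∀ w ∈ ball (0 : X) 1,
      ‖f w - f z - (w - z) - H z (w - z)‖ ≤ L / 2 * ‖w - z‖ ^ 2 := by
    intro w hw
    have := norm_image_sub_sub_le (h := f) (H := fun z => ContinuousLinearMap.id ℂ X + H z)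
      (convex_ball (0 : X) 1) hf
      (fun p hp q hq => by rw [add_sub_add_left_eq_sub]; exact hL p hp q hq) hzb hw
    simpa [sub_sub, add_assoc] using this
  have hxz : x - z = (t : ℂ) • (x - y) := by rw [hz]; module
  have hyz : y - z = (1 - (t : ℂ)) • (y - x) := by rw [hz]; module
  have h1t : (1 - (t : ℂ)) = ((1 - t : ℝ) : ℂ) := by push_cast; rfl
  have hX := htay x (mem_ball_zero_iff.2 hx)
  have hY := htay y (mem_ball_zero_iff.2 hy)
  have nx : ‖x - z‖ = t * ‖x - y‖ := by
    rw [hxz, norm_smul, Complex.norm_real, Real.norm_of_nonneg ht0]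
  have ny : ‖y - z‖ = (1 - t) * ‖x - y‖ := by
    rw [hyz, h1t, norm_smul, Complex.norm_real, Real.norm_of_nonneg ht', norm_sub_rev]
  rw [nx] at hX
  rw [ny] at hY
  -- The first-order terms cancel since (1-t)(x-z) + t(y-z) = 0. The Taylor remainders add up to L/2
  -- times (1-t)t² + t(1-t)² = t(1-t), times ‖x-y‖².
  have hdist : ‖(1 - (t : ℂ)) • f x + (t : ℂ) • f y - f z‖ ≤ L * (d / 2) := by
    have e : (1 - (t : ℂ)) • f x + (t : ℂ) • f y - f z =
        ((1 - t : ℝ) : ℂ) • (f x - f z - (x - z) - H z (x - z)) +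
          (t : ℂ) • (f y - f z - (y - z) - H z (y - z)) := by
      rw [hxz, hyz, map_smul, map_smul, ← neg_sub x y, map_neg, ← h1t]
      module
    rw [e]
    refine (norm_add_le _ _).trans ?_
    rw [norm_smul, norm_smul, Complex.norm_real, Complex.norm_real, Real.norm_of_nonneg ht0,
      Real.norm_of_nonneg ht']
    calc _ ≤ (1 - t) * (L / 2 * (t * ‖x - y‖) ^ 2) +
          t * (L / 2 * ((1 - t) * ‖x - y‖) ^ 2) := by gcongr
      _ = _ := by rw [hd]; ring
  rcases subsingleton_or_nontrivial X with hS | hN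
  · exact ⟨0, by simp, Subsingleton.elim _ _⟩
  -- The image of the closed ball of radius d/2 about z contains the one of radius (1-a)d/2 about f
  -- z, and L ≤ 1-a.
  have hsurj := hA.surjOn_closedBall_of_nonlinearRightInverse
    (ContinuousLinearEquiv.refl ℂ X).toNonlinearRightInverse (by positivity : 0 ≤ d / 2) hsub
  have hN1 : (((ContinuousLinearEquiv.refl ℂ X).toNonlinearRightInverse.nnnorm : NNReal) : ℝ) = 1 :=
    ContinuousLinearMap.norm_id
  rw [hN1, inv_one] at hsurj
  obtain ⟨w, hw, hfw⟩ := hsurj (show (1 - (t : ℂ)) • f x + (t : ℂ) • f y ∈ _ by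
    rw [mem_closedBall, dist_eq_norm]
    refine hdist.trans ?_
    gcongr
    linarith)
  exact ⟨w, hsub hw, hfw⟩

end Perturbation

/-! ### Starlikeness of the image. -/

section Starlike

variable {X : Type*} [NormedAddCommGroup X] [InnerProductSpace ℂ X]

lemma re_inner_pos_of_perturbation {v w p : X} {T : X →L[ℂ] X} {a : ℝ} (ha : 5 * a ^ 2 ≤ 4)
    (hv0 : v ≠ 0) (hv : ‖v‖ < 1) (hT : ‖T‖ ≤ a * ‖v‖) (hp : ‖p‖ ≤ a / 2 * ‖v‖ ^ 2)
    (hw : w + T w = v + p) : 0 < (inner ℂ v w).re := by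
  have hr : 0 < ‖v‖ := norm_pos_iff.2 hv0
  have h1 : ‖w - v‖ ≤ ‖v‖ * (a * ‖w‖ + a / 2 * ‖v‖) := by
    have e : w - v = p - T w := by
      rw [sub_eq_sub_iff_add_eq_add, hw, add_comm]
    rw [e]
    calc _ ≤ ‖p‖ + ‖T‖ * ‖w‖ := (norm_sub_le _ _).trans (by gcongr; exact T.le_opNorm w)
      _ ≤ a / 2 * ‖v‖ ^ 2 + a * ‖v‖ * ‖w‖ := by gcongr
      _ = _ := by ring
  -- Cauchy–Schwarz with coefficients a and a/2, whose squares sum to 5a²/4 ≤ 1.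
  have h2 : (a * ‖w‖ + a / 2 * ‖v‖) ^ 2 ≤ ‖w‖ ^ 2 + ‖v‖ ^ 2 := by
    have : (a * ‖w‖ + a / 2 * ‖v‖) ^ 2 ≤ 5 * a ^ 2 / 4 * (‖w‖ ^ 2 + ‖v‖ ^ 2) := by
      nlinarith [mul_nonneg (sq_nonneg a) (sq_nonneg (‖w‖ - 2 * ‖v‖))]
    nlinarith [sq_nonneg ‖w‖, sq_nonneg ‖v‖]
  have h3 : ‖w - v‖ ^ 2 ≤ ‖v‖ ^ 2 * (‖w‖ ^ 2 + ‖v‖ ^ 2) := by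
    calc ‖w - v‖ ^ 2 ≤ (‖v‖ * (a * ‖w‖ + a / 2 * ‖v‖)) ^ 2 := by gcongr
      _ = ‖v‖ ^ 2 * (a * ‖w‖ + a / 2 * ‖v‖) ^ 2 := by ring
      _ ≤ _ := by gcongr
  have h4 : ‖v‖ ^ 2 < 1 := by nlinarith
  -- Expanding ‖w-v‖² gives 2 Re⟨v,w⟩ ≥ (1-‖v‖²)(‖w‖²+‖v‖²) > 0.
  rw [norm_sub_sq (𝕜 := ℂ), inner_re_symm, RCLike.re_to_complex] at h3
  nlinarith [sq_nonneg ‖w‖, sq_pos_of_pos hr]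

lemma hasDerivAt_norm_sq {g : ℝ → X} {g' : X} {s : ℝ} (hg : HasDerivAt g g' s) :
    HasDerivAt (fun s => ‖g s‖ ^ 2) (2 * (inner ℂ (g s) g').re) s := by
  let _ : InnerProductSpace ℝ X := InnerProductSpace.complexToReal
  exact hg.norm_sq

/-- On the complete ball f is Lipschitz and expands distances by at least a positive factor, so
Cauchy sequences in the image lift. -/
lemma isClosed_image_closedBall [CompleteSpace X] {f : X → X} {a : NNReal} (ha : a < 1)
    (hA : ApproximatesLinearOn f (ContinuousLinearEquiv.refl ℂ X : X →L[ℂ] X) (ball 0 1) a)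
    {r : ℝ} (hr : r < 1) : IsClosed (f '' closedBall 0 r) := by
  have hA' := hA.mono_set (closedBall_subset_ball (x := (0 : X)) hr)
  have : CompleteSpace (closedBall (0 : X) r) := isClosed_closedBall.completeSpace_coe
  rw [← Set.range_domRestrict]
  exact (hA'.antilipschitz (subsingleton_or_lt_refl_inv ha)).isClosed_range
    hA'.lipschitz.uniformContinuous

lemma starlike_of_perturbation [CompleteSpace X] {f : X → X} {H : X → X →L[ℂ] X} {a : NNReal}
    (ha : 5 * (a : ℝ) ^ 2 ≤ 4) (f0 : f 0 = 0)
    (hf : ∀ z ∈ ball (0 : X) 1, HasFDerivAt f (ContinuousLinearMap.id ℂ X + H z) z)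
    (hH : ∀ z ∈ ball (0 : X) 1, ‖H z‖ ≤ a * ‖z‖)
    (hp : ∀ z ∈ ball (0 : X) 1, ‖f z - z‖ ≤ a / 2 * ‖z‖ ^ 2)
    {z : X} (hz : z ∈ ball (0 : X) 1) {t : ℝ} (ht0 : 0 ≤ t) (ht1 : t ≤ 1) :
    (t : ℂ) • f z ∈ f '' ball (0 : X) 1 := by
  have ha1 : a < 1 := by
    rw [← NNReal.coe_lt_coe, NNReal.coe_one]
    nlinarith [a.coe_nonneg]
  have hH' : ∀ z ∈ ball (0 : X) 1, ‖H z‖ ≤ a := fun z hz =>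
    (hH z hz).trans (mul_le_of_le_one_right a.coe_nonneg (mem_ball_zero_iff.1 hz).le)
  have hA := approximatesLinearOn_id (convex_ball (0 : X) 1) hf hH'
  obtain ⟨e, hs, het, he, hD⟩ := exists_openPartialHomeomorph ha1 hf hH'
  have hz1 : ‖z‖ < 1 := mem_ball_zero_iff.1 hz
  have hsub : closedBall (0 : X) ‖z‖ ⊆ ball 0 1 := closedBall_subset_ball hz1
  have hcont : Continuous fun s : ℝ => (1 - (s : ℂ)) • f z := by fun_prop
  -- Continuous induction on s: the set of good s is closed, and each good s < 1 has good points
  -- just to its right.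
  have hIcc : Icc (0 : ℝ) 1 ⊆ {s : ℝ | (1 - (s : ℂ)) • f z ∈ f '' closedBall 0 ‖z‖} := by
    refine IsClosed.Icc_subset_of_forall_exists_gt
      (((isClosed_image_closedBall ha1 hA hz1).preimage hcont).inter isClosed_Icc)
      ⟨z, by simp, by simp⟩ ?_
    rintro s ⟨⟨v, hv, hfv⟩, hs0, hs1⟩ y hy
    have hs1' : 0 < 1 - s := by linarith
    have hsC : 1 - (s : ℂ) = ((1 - s : ℝ) : ℂ) := by push_cast; rfl
    have hsC0 : 1 - (s : ℂ) ≠ 0 := by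
      rw [hsC]; exact_mod_cast hs1'.ne'
    rcases eq_or_ne v 0 with rfl | hv0
    -- If the preimage is 0 the whole path is constantly 0, so y itself is good.
    · have : f z = 0 := by
        rw [f0] at hfv
        simpa [hsC0] using hfv.symm
      exact ⟨y, ⟨0, by simp, by simp [f0, this]⟩, hy, le_rfl⟩
    · have hvb := hsub hv
      obtain ⟨D, hDv, hDw⟩ := hD v hvb
      have hpos : 0 < (inner ℂ v (D (f v))).re :=
        re_inner_pos_of_perturbation ha hv0 (mem_ball_zero_iff.1 hvb) (hH v hvb) (hp v hvb)
          (by rw [hDw, add_sub_cancel])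
      have hev : e.symm (f v) = v := by rw [← he]; exact e.left_inv (hs ▸ hvb)
      have hlin : HasDerivAt (fun s : ℝ => (1 - (s : ℂ)) • f z) (-f z) s := by
        simpa using ((Complex.ofRealCLM.hasDerivAt (x := s)).const_sub 1).smul_const (f z)
      -- Since f z = f(v)/(1-s), this derivative is a negative multiple of Re⟨v, Df(v)⁻¹f(v)⟩.
      have hφ : HasDerivAt (fun s : ℝ => ‖e.symm ((1 - (s : ℂ)) • f z)‖ ^ 2)
          (2 * (inner ℂ v (D (-f z))).re) s := by
        have h1 : HasFDerivAt e.symm D ((1 - (s : ℂ)) • f z) := hfv ▸ hDv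
        have := hasDerivAt_norm_sq ((h1.restrictScalars ℝ).comp_hasDerivAt s hlin)
        simpa [← hfv, hev] using this
      have hneg : 2 * (inner ℂ v (D (-f z))).re < 0 := by
        rw [hfv, map_smul, hsC, inner_smul_right, Complex.re_ofReal_mul] at hpos
        rw [map_neg, inner_neg_right, Complex.neg_re]
        have := (mul_pos_iff_of_pos_left hs1').1 hpos
        linarith
      have hlt : ∀ᶠ s' : ℝ in 𝓝[>] s, ‖e.symm ((1 - (s' : ℂ)) • f z)‖ ^ 2 < ‖v‖ ^ 2 := by
        have := (hasDerivAt_iff_tendsto_slope.1 hφ).eventually (gt_mem_nhds hneg)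
        filter_upwards [this.filter_mono (nhdsWithin_mono s fun x hx => ne_of_gt (mem_Ioi.1 hx)),
          self_mem_nhdsWithin] with s' h1 h2
        rw [slope_def_field, ← hfv, hev, div_neg_iff] at h1
        have h2' : 0 < s' - s := sub_pos.2 h2
        rcases h1 with h1 | h1 <;> linarith [h1.1, h1.2]
      have hmem : ∀ᶠ s' : ℝ in 𝓝[>] s, (1 - (s' : ℂ)) • f z ∈ e.target := by
        refine (hcont.continuousAt.eventually_mem ?_).filter_mono nhdsWithin_le_nhds
        rw [← hfv]
        exact e.open_target.mem_nhds (het ▸ mem_image_of_mem f hvb)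
      obtain ⟨s', h1, h2, h3⟩ :=
        (hlt.and (hmem.and (Ioc_mem_nhdsGT (mem_Ioi.1 hy)))).exists
      refine ⟨s', ⟨e.symm ((1 - (s' : ℂ)) • f z), ?_, ?_⟩, h3⟩
      · rw [mem_closedBall_zero_iff] at hv ⊢
        exact (lt_of_pow_lt_pow_left₀ 2 (norm_nonneg _) h1).le.trans hv
      · rw [← he]
        exact e.right_inv h2
  have := hIcc (show 1 - t ∈ Icc (0 : ℝ) 1 from ⟨by linarith, by linarith⟩)
  have h2 : (1 - ((1 - t : ℝ) : ℂ)) = t := by push_cast; ring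
  rw [mem_ofPred_eq, h2] at this
  exact image_mono hsub this

end Starlike

/-! ### Numerical consequences of the coefficient condition. -/

lemma five_mul_AConst_sq_le {α : ℝ} (hα₀ : 0 ≤ α) (hα₁ : α < 1) :
    5 * AConst α ^ 2 ≤ (2 - α) ^ 2 := by
  unfold AConst
  -- Equality occurs only at α = 0. The first branch reduces to 5(1-2α) ≤ 5-2α.
  split_ifs with h1 h2 h3
  · rw [div_pow, mul_pow, Real.sq_sqrt (by linarith), Real.sq_sqrt (by linarith), mul_div_assoc',
      div_le_iff₀ (by linarith)]
    nlinarith [mul_nonneg (sq_nonneg (2 - α)) hα₀]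
  · rw [div_pow, mul_div_assoc', div_le_iff₀ (by positivity), mul_pow]
    have : 5 * (1 - α) ^ 2 ≤ (2 + α) ^ 2 := by nlinarith
    nlinarith [sq_nonneg (2 - α)]
  · nlinarith
  · nlinarith

/-- The coefficient condition defining the two classes controls `∑ k u_k`. -/
lemma summable_and_five_mul_tsum_sq_le {α : ℝ} (hα₀ : 0 ≤ α) (hα₁ : α < 1) {u : ℕ → ℝ}
    (hu : ∀ k, 0 ≤ u k) (hs : Summable fun k : ℕ => (((k + 2 : ℕ) : ℝ) - α) * u k)
    (hle : ∑' k : ℕ, (((k + 2 : ℕ) : ℝ) - α) * u k ≤ AConst α) :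
    (Summable fun k : ℕ => ((k + 2 : ℕ) : ℝ) * u k) ∧
      5 * (∑' k : ℕ, ((k + 2 : ℕ) : ℝ) * u k) ^ 2 ≤ 4 := by
  -- The factor (2-α)/2 is the least value of (k-α)/k for k ≥ 2, attained at k = 2.
  have hterm : ∀ k : ℕ, (2 - α) / 2 * (((k + 2 : ℕ) : ℝ) * u k) ≤
      (((k + 2 : ℕ) : ℝ) - α) * u k := by
    intro k
    rw [← mul_assoc]
    refine mul_le_mul_of_nonneg_right ?_ (hu k)
    push_cast
    nlinarith [mul_nonneg (Nat.cast_nonneg k : (0 : ℝ) ≤ k) hα₀]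
  have h2 : 0 < (2 - α) / 2 := by linarith
  have hs' : Summable fun k : ℕ => ((k + 2 : ℕ) : ℝ) * u k :=
    (summable_mul_left_iff h2.ne').1 (Summable.of_nonneg_of_le
      (fun k => mul_nonneg h2.le (mul_nonneg (Nat.cast_nonneg _) (hu k))) hterm hs)
  refine ⟨hs', ?_⟩
  have h3 := ((hs'.mul_left ((2 - α) / 2)).tsum_le_tsum hterm hs).trans hle
  rw [tsum_mul_left] at h3
  have h0 : 0 ≤ ∑' k : ℕ, ((k + 2 : ℕ) : ℝ) * u k :=
    tsum_nonneg fun k => mul_nonneg (Nat.cast_nonneg _) (hu k)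
  set a := ∑' k : ℕ, ((k + 2 : ℕ) : ℝ) * u k
  have h4 : ((2 - α) / 2 * a) ^ 2 ≤ AConst α ^ 2 := by gcongr
  have h5 := five_mul_AConst_sq_le hα₀ hα₁
  have h6 : (2 - α) ^ 2 * (5 * a ^ 2) ≤ (2 - α) ^ 2 * 4 := by nlinarith
  exact le_of_mul_le_mul_left h6 (pow_pos (by linarith) 2)

/-! ### Membership in the classes, and the operator f ↦ Df(z)z. -/

section Classes

variable {X : Type*} [NormedAddCommGroup X] [InnerProductSpace ℂ X]
  {A : (k : ℕ) → ContinuousMultilinearMap ℂ (fun _ : Fin k => X) X} {f : X → X}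

lemma HasNormalizedExpansion.map_zero (hf : HasNormalizedExpansion f A) : f 0 = 0 := by
  have h := hf.2.2 0 (by simp)
  have h0 : ∀ k : ℕ, A (k + 2) (fun _ => (0 : X)) = 0 := fun k => (A (k + 2)).map_zero
  simp only [h0, sub_zero] at h
  exact h.unique hasSum_zero

/-- A holomorphic mapping on the unit ball is determined by `f(0)` and `Df(z)z`. -/
lemma eqOn_ball_of_fderiv_apply_self {g : X → X} (hf : DifferentiableOn ℂ f (ball 0 1))
    (hg : DifferentiableOn ℂ g (ball 0 1)) (h0 : f 0 = g 0)
    (h : ∀ z ∈ ball (0 : X) 1, fderiv ℂ f z z = fderiv ℂ g z z) : EqOn f g (ball 0 1) := by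
  intro z hz
  rw [mem_ball_zero_iff] at hz
  have hmem : ∀ s ∈ Icc (0 : ℝ) 1, ((1 - s : ℝ) : ℂ) • z ∈ ball (0 : X) 1 := fun s hs => by
    rw [mem_ball_zero_iff, norm_smul, Complex.norm_real, Real.norm_of_nonneg (by linarith [hs.2])]
    exact (mul_le_of_le_one_left (norm_nonneg z) (by linarith [hs.1])).trans_lt hz
  have hd : ∀ s ∈ Icc (0 : ℝ) 1,
      HasDerivAt (fun s : ℝ => f (((1 - s : ℝ) : ℂ) • z) - g (((1 - s : ℝ) : ℂ) • z))
        (fderiv ℂ f (((1 - s : ℝ) : ℂ) • z) (-z) - fderiv ℂ g (((1 - s : ℝ) : ℂ) • z) (-z)) s := by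
    intro s hs
    have hl : HasDerivAt (fun s : ℝ => ((1 - s : ℝ) : ℂ) • z) (-z) s := by
      simpa using ((Complex.ofRealCLM.hasDerivAt (x := s)).const_sub 1).smul_const z
    have hn := isOpen_ball.mem_nhds (hmem s hs)
    exact ((((hf.differentiableAt hn).hasFDerivAt).restrictScalars ℝ).comp_hasDerivAt s hl).sub
      ((((hg.differentiableAt hn).hasFDerivAt).restrictScalars ℝ).comp_hasDerivAt s hl)
  -- The ray runs from z to 0, so right derivatives are needed only where 1-s ≠ 0, and this scalar
  -- can be cancelled.
  have hc := constant_of_has_deriv_right_zero (a := (0 : ℝ)) (b := 1)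
    (fun s hs => (hd s hs).continuousAt.continuousWithinAt)
    (fun s hs => by
      have h1 : ((1 - s : ℝ) : ℂ) ≠ 0 := by exact_mod_cast (sub_pos.2 hs.2).ne'
      refine ((hd s (Ico_subset_Icc_self hs)).congr_deriv ?_).hasDerivWithinAt
      have := h _ (hmem s (Ico_subset_Icc_self hs))
      rw [map_smul, map_smul] at this
      rw [map_neg, map_neg, smul_right_injective X h1 this, sub_self])
    1 (right_mem_Icc.2 zero_le_one)
  simp only [sub_self, Complex.ofReal_zero, zero_smul, h0, sub_zero, Complex.ofReal_one,
    one_smul] at hc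
  exact sub_eq_zero.1 hc.symm

variable [CompleteSpace X]

lemma HasNormalizedExpansion.hasFDerivAt_zero (hf : HasNormalizedExpansion f A)
    (hs : Summable fun k : ℕ => ((k + 2 : ℕ) : ℝ) * ‖A (k + 2)‖) :
    HasFDerivAt f (ContinuousLinearMap.id ℂ X) 0 := by
  have h := norm_seriesDeriv_le hs (z := 0) (by simp)
  rw [norm_zero, mul_zero, norm_le_zero_iff] at h
  simpa [h] using HasNormalizedExpansion.hasFDerivAt hs hf (mem_ball_self one_pos)

lemma HasNormalizedExpansion.mem_classSStar (hf : HasNormalizedExpansion f A)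
    (hs : Summable fun k : ℕ => ((k + 2 : ℕ) : ℝ) * ‖A (k + 2)‖)
    (hle : 5 * (∑' k : ℕ, ((k + 2 : ℕ) : ℝ) * ‖A (k + 2)‖) ^ 2 ≤ 4) : f ∈ classSStar X := by
  have h0 : 0 ≤ ∑' k : ℕ, ((k + 2 : ℕ) : ℝ) * ‖A (k + 2)‖ :=
    tsum_nonneg fun k => by positivity
  have hb : ∀ {w : X}, w ∈ ball (0 : X) 1 → ‖w‖ ≤ 1 := fun hw => (mem_ball_zero_iff.1 hw).le
  lift (∑' k : ℕ, ((k + 2 : ℕ) : ℝ) * ‖A (k + 2)‖) to NNReal using h0 with a ha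
  have ha1 : a < 1 := by
    rw [← NNReal.coe_lt_coe, NNReal.coe_one]
    nlinarith [a.coe_nonneg]
  have hd := fun z hz => HasNormalizedExpansion.hasFDerivAt hs hf (z := z) hz
  have hH : ∀ z ∈ ball (0 : X) 1, ‖seriesDeriv A z‖ ≤ a * ‖z‖ := fun z hz => by
    rw [ha]; exact norm_seriesDeriv_le hs (hb hz)
  have hbi := biholomorphicOn_of_perturbation ha1 hd fun z hz =>
    (hH z hz).trans (mul_le_of_le_one_right a.coe_nonneg (hb hz))
  refine ⟨⟨fun z hz => ⟨ball 0 1, isOpen_ball, hz, Subset.rfl, hbi⟩, hf.map_zero,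
    hf.hasFDerivAt_zero hs⟩, hbi, ?_⟩
  rintro t ht0 ht1 _ ⟨z, hz, rfl⟩
  refine starlike_of_perturbation hle hf.map_zero hd hH (fun z hz => ?_) hz ht0 ht1
  rw [← (hf.2.2 z hz).tsum_eq, ha]
  exact norm_series_le hs (hb hz)

/-- Split k² = k(k-1) + k: the first part bounds the Lipschitz constant of Dh, the second ‖Dh‖, and
their sum is below 1 as the convexity criterion requires. -/
lemma HasNormalizedExpansion.mem_classK (hf : HasNormalizedExpansion f A)
    (hs : Summable fun k : ℕ => ((k + 2 : ℕ) : ℝ) * (((k + 2 : ℕ) : ℝ) * ‖A (k + 2)‖))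
    (hle : ∑' k : ℕ, ((k + 2 : ℕ) : ℝ) * (((k + 2 : ℕ) : ℝ) * ‖A (k + 2)‖) < 1) :
    f ∈ classK X := by
  have hs1 : Summable fun k : ℕ => ((k + 2 : ℕ) : ℝ) * ‖A (k + 2)‖ := by
    refine Summable.of_nonneg_of_le (fun k => by positivity) (fun k => ?_) hs
    exact le_mul_of_one_le_left (by positivity) (by exact_mod_cast (by omega : 1 ≤ k + 2))
  have hs2 : Summable fun k : ℕ => ((k + 2 : ℕ) : ℝ) * (k + 1 : ℕ) * ‖A (k + 2)‖ := by
    refine (hs.sub hs1).congr fun k => ?_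
    push_cast
    ring
  have hsum : ∑' k : ℕ, ((k + 2 : ℕ) : ℝ) * (k + 1 : ℕ) * ‖A (k + 2)‖ +
      ∑' k : ℕ, ((k + 2 : ℕ) : ℝ) * ‖A (k + 2)‖ < 1 := by
    rw [← hs2.tsum_add hs1]
    refine (tsum_congr fun k => ?_).trans_lt hle
    push_cast
    ring
  have h0 : 0 ≤ ∑' k : ℕ, ((k + 2 : ℕ) : ℝ) * ‖A (k + 2)‖ :=
    tsum_nonneg fun k => by positivity
  have hL0 : 0 ≤ ∑' k : ℕ, ((k + 2 : ℕ) : ℝ) * (k + 1 : ℕ) * ‖A (k + 2)‖ :=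
    tsum_nonneg fun k => by positivity
  have hb : ∀ {w : X}, w ∈ ball (0 : X) 1 → ‖w‖ ≤ 1 := fun hw => (mem_ball_zero_iff.1 hw).le
  have hd := fun z hz => HasNormalizedExpansion.hasFDerivAt hs1 hf (z := z) hz
  have hH : ∀ z ∈ ball (0 : X) 1,
      ‖seriesDeriv A z‖ ≤ ∑' k : ℕ, ((k + 2 : ℕ) : ℝ) * ‖A (k + 2)‖ := fun z hz =>
    (norm_seriesDeriv_le hs1 (hb hz)).trans (mul_le_of_le_one_right h0 (hb hz))
  lift (∑' k : ℕ, ((k + 2 : ℕ) : ℝ) * ‖A (k + 2)‖) to NNReal using h0 with a ha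
  have ha1 : a < 1 := by
    rw [← NNReal.coe_lt_coe, NNReal.coe_one]
    linarith
  exact ⟨biholomorphicOn_of_perturbation ha1 hd hH,
    fun x hx y hy t ht0 ht1 => convex_combination_mem_image hsum.le hd hH
      (fun x hx y hy => norm_seriesDeriv_sub_le hs1 hs2 (hb hx) (hb hy)) hx hy ht0 ht1,
    hf.map_zero, hf.hasFDerivAt_zero hs1⟩

/-- If `f` has a normalized expansion with coefficients `A_k`, then `z ↦ Df(z)z` has one with
coefficients `k A_k`. -/
lemma HasNormalizedExpansion.fderiv_apply_self (hf : HasNormalizedExpansion f A)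
    (hs : Summable fun k : ℕ => ((k + 2 : ℕ) : ℝ) * (((k + 2 : ℕ) : ℝ) * ‖A (k + 2)‖)) :
    HasNormalizedExpansion (fun z => fderiv ℂ f z z) fun k => (k : ℂ) • A k := by
  have hs1 : Summable fun k : ℕ => ((k + 2 : ℕ) : ℝ) * ‖A (k + 2)‖ := by
    refine Summable.of_nonneg_of_le (fun k => by positivity) (fun k => ?_) hs
    exact le_mul_of_one_le_left (by positivity) (by exact_mod_cast (by omega : 1 ≤ k + 2))
  have hsym : ∀ (k : ℕ) (σ : Equiv.Perm (Fin k)) (v : Fin k → X),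
      ((k : ℂ) • A k) (fun i => v (σ i)) = ((k : ℂ) • A k) v := fun k σ v => by
    rw [_root_.smul_apply, _root_.smul_apply, hf.2.1]
  have hsum : ∀ z ∈ ball (0 : X) 1,
      HasSum (fun k : ℕ => (((k + 2 : ℕ) : ℂ) • A (k + 2)) fun _ => z)
        (fderiv ℂ f z z - z) := fun z hz => by
    rw [(HasNormalizedExpansion.hasFDerivAt hs1 hf hz).fderiv]
    simpa using hasSum_seriesDeriv_self hs1 (mem_ball_zero_iff.1 hz).le
  refine ⟨fun z hz => ?_, hsym, hsum⟩
  have hs' : Summable fun k : ℕ => ((k + 2 : ℕ) : ℝ) * ‖((k + 2 : ℕ) : ℂ) • A (k + 2)‖ := by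
    simpa only [norm_smul, Complex.norm_natCast] using hs
  have h := (hasFDerivAt_id (𝕜 := ℂ) z).add
    (hasFDerivAt_series (A := fun k => (k : ℂ) • A k) hs' hsym hz)
  refine (h.congr_of_eventuallyEq ?_).differentiableAt.differentiableWithinAt
  filter_upwards [isOpen_ball.mem_nhds hz] with w hw
  simp only [Pi.add_apply, id]
  rw [(hsum w hw).tsum_eq, add_sub_cancel]

end Classes

theorem theorem3 {X : Type*} [NormedAddCommGroup X] [InnerProductSpace ℂ X] [CompleteSpace X]
    (α : ℝ) (hα₀ : 0 ≤ α) (hα₁ : α < 1) :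
    classSK X α ⊆ classK X ∧
    classSSStar X α ⊆ classSStar X ∧
    ∀ f : X → X, DifferentiableOn ℂ f (Metric.ball 0 1) → f 0 = 0 →
      (f ∈ classSK X α ↔ (fun z => fderiv ℂ f z z) ∈ classSSStar X α) := by
  have hSK : ∀ A : (k : ℕ) → ContinuousMultilinearMap ℂ (fun _ : Fin k => X) X, ∀ k : ℕ,
      ((k + 2 : ℕ) : ℝ) * (((k + 2 : ℕ) : ℝ) - α) * ‖A (k + 2)‖ =
        (((k + 2 : ℕ) : ℝ) - α) * (((k + 2 : ℕ) : ℝ) * ‖A (k + 2)‖) := fun A k => by ring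
  refine ⟨?_, ?_, fun f hf f0 => ⟨?_, ?_⟩⟩
  · rintro f ⟨A, hA, hs, hle⟩
    simp only [hSK] at hs hle
    obtain ⟨h1, h2⟩ := summable_and_five_mul_tsum_sq_le hα₀ hα₁ (fun k => by positivity) hs hle
    exact hA.mem_classK h1 (by nlinarith)
  · rintro f ⟨A, hA, hs, hle⟩
    obtain ⟨h1, h2⟩ := summable_and_five_mul_tsum_sq_le hα₀ hα₁ (fun k => by positivity) hs hle
    exact hA.mem_classSStar h1 h2
  · rintro ⟨A, hA, hs, hle⟩
    simp only [hSK] at hs hle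
    obtain ⟨h1, -⟩ := summable_and_five_mul_tsum_sq_le hα₀ hα₁ (fun k => by positivity) hs hle
    refine ⟨_, hA.fderiv_apply_self h1, ?_⟩
    simpa only [norm_smul, Complex.norm_natCast] using ⟨hs, hle⟩
  · rintro ⟨A, hA, hs, hle⟩
    -- Dividing by k undoes f ↦ Df(z)z; the value 0⁻¹ = 0 at k = 0 plays no role, as only k ≥ 2
    -- enters.
    let C : (k : ℕ) → ContinuousMultilinearMap ℂ (fun _ : Fin k => X) X := fun k => (k : ℂ)⁻¹ • A k
    have hC : ∀ k : ℕ, ((k + 2 : ℕ) : ℝ) * ‖C (k + 2)‖ = ‖A (k + 2)‖ := fun k => by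
      rw [norm_smul, norm_inv, Complex.norm_natCast]
      field_simp
    have hsymm : ∀ (k : ℕ) (σ : Equiv.Perm (Fin k)) (v : Fin k → X),
        C k (fun i => v (σ i)) = C k v := fun k σ v => by
      simp only [C, _root_.smul_apply, hA.2.1]
    obtain ⟨h1, -⟩ := summable_and_five_mul_tsum_sq_le hα₀ hα₁ (fun k => by positivity) hs hle
    have hsC : Summable fun k : ℕ => ((k + 2 : ℕ) : ℝ) * ‖C (k + 2)‖ := by
      refine Summable.of_nonneg_of_le (fun k => by positivity) (fun k => ?_) h1
      rw [hC]
      exact le_mul_of_one_le_left (norm_nonneg _) (by exact_mod_cast (by omega : 1 ≤ k + 2))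
    have hb : ∀ {w : X}, w ∈ ball (0 : X) 1 → ‖w‖ ≤ 1 := fun hw => (mem_ball_zero_iff.1 hw).le
    have hF : HasNormalizedExpansion (fun z => z + ∑' k, C (k + 2) fun _ => z) C :=
      ⟨fun z hz => ((hasFDerivAt_id z).add
        (hasFDerivAt_series hsC hsymm hz)).differentiableAt.differentiableWithinAt, hsymm,
        fun z hz => by simpa using (summable_diag hsC (hb hz)).hasSum⟩
    have hEq := eqOn_ball_of_fderiv_apply_self hf hF.1 (by rw [f0, hF.map_zero]) fun z hz => by
      have e1 := hasSum_seriesDeriv_self hsC (hb hz)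
      have e2 := hA.2.2 z hz
      have e3 : ∀ k : ℕ, (((k + 2 : ℕ) : ℂ) • C (k + 2) fun _ => z) = A (k + 2) fun _ => z := by
        intro k
        have : ((k + 2 : ℕ) : ℂ) ≠ 0 := Nat.cast_ne_zero.2 (by omega)
        simp only [C, _root_.smul_apply]
        rw [smul_inv_smul₀ this]
      simp only [e3] at e1
      rw [(HasNormalizedExpansion.hasFDerivAt hsC hF hz).fderiv]
      have := e2.unique e1
      simp only [_root_.add_apply, ContinuousLinearMap.id_apply]
      rw [← this, add_sub_cancel]
    refine ⟨C, ⟨hf, hsymm, fun z hz => ?_⟩, ?_⟩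
    · rw [hEq hz]
      exact hF.2.2 z hz
    · simp only [hSK, hC]
      exact ⟨hs, hle⟩
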